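/- Let $n$ be a positive integer, let $[n]=\{1,\dots,n\}$, and let $\lambda$ be a non-zero partition with fewer than $n$ non-zero parts. Let $c_1\ge\dots\ge c_{\lambda_1}$ be the column lengths of its Young diagram, let $\zeta_1<\dots<\zeta_d$ be the distinct values among them, and put $\zeta_0=0$, $\zeta_{d+1}=n$. Let $\mathcal T_\lambda$ be the set of semistandard tableaux of shape $\lambda$ with values in $[n]$ (rows weakly increase from left to right, columns strictly increase from top to bottom). Write $T(j,i)$ for the value of $T$ in column $j$ and row $i$, and $C_1,\dots,C_{\lambda_1}$ for the columns of $T$. Inequalities between fillings of $\lambda$ are meant entry by entry. Permutations $\phi\in S_n$ are written in one-rowed form $(\phi_1,\dots,\phi_n)$. The Bruhat order on $S_n$ is the reflexive and transitive order generated by $\phi<\psi$ whenever $\psi$ arises from $\phi$ by interchanging two entries $\phi_a<\phi_b$ with $a<b$. Let $S_n^\lambda$ be the set of all $\phi\in S_n$ with $\phi_{\zeta_{h-1}+1}<\dots<\phi_{\zeta_h}$ for $1\le h\le d+1$. For $\phi\in S_n$, the key $Y_\lambda(\phi)$ is the filling of $\lambda$ whose columns of length $\zeta_h$ contain $\phi_1,\dots,\phi_{\zeta_h}$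 in increasing order, $1\le h\le d$. The right key $R(T)$ of Lascoux and Schützenberger is the filling of $\lambda$ whose $j$-th column is obtained as follows: start with $D=C_j$, and for $l=j+1,\dots,\lambda_1$ replace $D$ by the right-hand column, of length $c_j$, that arises when the two adjacent columns $D,C_l$, aligned at the top and of lengths $c_j\ge c_l$, are turned by $c_j-c_l$ jeu de taquin slides into the empty boxes below the right-hand column into two columns of lengths $c_l,c_j$; the $j$-th column of $R(T)$ is the final $D$. For $w\in S_n^\lambda$ define the Demazure generating set $$\mathcal D_{\lambda,w}=\{T\in\mathcal T_\lambda : R(T)\le Y_\lambda(w)\}.$$ The permutation $\pi_T$ (the final permutation produced from $T$ by the inverse of the filling map in the type A alcove model) is obtained as follows. Start with the permutation $\pi$ whose first $c_1$ entries are the values in $C_1$ in increasing order and whose other entries are the remaining values of $[n]$ in increasing order. For $j=2,\dots,\lambda_1$, and for each such $j$ for $i=c_j,c_j-1,\dots,1$, modify $\pi$ as follows: put $i_0=i$; as long as $\pi_{i_x}<T(j,i)$, let $i_{x+1}$ be the smallest index greater than $c_j$ with $\pi_{i_x}<\pi_{i_{x+1}}\le T(j,i)$; when $\pi_{i_m}=T(j,i)$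 is reached, move the entry $\pi_{i_{x-1}}$ to position $i_x$ for $1\le x\le m$ and the entry $\pi_{i_m}$ to position $i_0$, and leave the other entries unchanged. Then $\pi_T$ is the permutation obtained at the end. **Theorem.** Let $T\in\mathcal T_\lambda$ and $w\in S_n^\lambda$. Then $T\in\mathcal D_{\lambda,w}$ if and only if $\pi_T\le w$ in the Bruhat order. -/

import Mathlib

/-!
Conventions.  Rows, columns, positions and values are all counted from `0`, so that `[n]` is
`{0, …, n - 1}`, the cell in row `i` and column `j` of a Young diagram is `(i, j)`, the length of
column `j` is `μ.colLen j`, and the number of columns is `μ.rowLen 0`.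
-/

namespace Demazure

/-- The `n`-semistandard tableaux of shape `μ`: the semistandard tableaux with values in
`{0, …, n - 1}`. -/
def Tableau (n : ℕ) (μ : YoungDiagram) : Type :=
  {T : SemistandardYoungTableau μ // ∀ i j, (i, j) ∈ μ → T i j < n}

/-- The value of the tableau `T` in row `i` of column `j`. -/
def Tableau.val {n : ℕ} {μ : YoungDiagram} (T : Tableau n μ) (i j : ℕ) : ℕ := T.1 i j

/-! ### Permutations -/

/-- The Bruhat order on the symmetric group: the reflexive and transitive closure of the relation
between `u` and `u * (a b)` for positions `a < b` with `u a < u b`, that is, of the multiplications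
by a transposition that increase the number of inversions. -/
def BruhatLE {n : ℕ} : Equiv.Perm (Fin n) → Equiv.Perm (Fin n) → Prop :=
  Relation.ReflTransGen fun u v => ∃ a b : Fin n, a < b ∧ u a < u b ∧ v = u * Equiv.swap a b

/-- The permutations whose one-rowed form increases on every block of positions between two
consecutive column lengths of `μ` (with `0` and `n` added to the column lengths).  Positions
`a < b` lie in different blocks if and only if some column length `c` satisfies `a < c ≤ b`. -/
def minimalReps (n : ℕ) (μ : YoungDiagram) : Set (Equiv.Perm (Fin n)) :=
  {w | ∀ a b : Fin n, a < b → (∀ j, ¬ ((a : ℕ) < μ.colLen j ∧ μ.colLen j ≤ (b : ℕ))) → w a < w b}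

/-- The `μ`-key of the permutation `w`, as a filling of the cells of `μ`: column `j`, of length
`c`, holds the first `c` entries of the one-rowed form of `w` in increasing order, so that row `i`
of it is the `i`-th smallest of them. -/
noncomputable def keyOfPerm {n : ℕ} (μ : YoungDiagram) (w : Equiv.Perm (Fin n)) (i j : ℕ) : ℕ :=
  Nat.nth (fun x => ∃ k : Fin n, (k : ℕ) < μ.colLen j ∧ (w k : ℕ) = x) i

/-! ### The right key

Two adjacent columns of a skew tableau are given by functions `L` (left) and `R` (right) on the
rows.  Only the rows that belong to the columns matter. -/

/-- A slide of jeu de taquin begins with an empty box at the bottom of the right column.  As long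
as the box above is at least as large as the box to the left, the box above moves down into
the empty box; otherwise the box to the left moves right into it.  If the empty box is in row `r`,
this is the row in which the box to the left moves right. -/
def slideRow (L R : ℕ → ℕ) : ℕ → ℕ
  | 0 => 0
  | r + 1 => if R r < L (r + 1) then r + 1 else slideRow L R r

/-- The two columns after one slide of jeu de taquin into the empty box in row `q` of the right
column.  The entry that moves from the left column to the right one leaves an empty box in the
left column, into which the part of the left column above it moves down. -/
def slide (L R : ℕ → ℕ) (q : ℕ) : (ℕ → ℕ) × (ℕ → ℕ) :=
  let r := slideRow L R q
  (fun i => if i ≤ r then L (i - 1) else L i,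
   fun i => if i < r then R i else if i = r then L r else R (i - 1))

/-- The two columns after `k` slides, into the rows `q, q + 1, …, q + k - 1` of a right column
which has length `q` at the start. -/
def slides (L R : ℕ → ℕ) (q : ℕ) : ℕ → (ℕ → ℕ) × (ℕ → ℕ)
  | 0 => (L, R)
  | k + 1 => slide (slides L R q k).1 (slides L R q k).2 (q + k)

/-- Start from column `j` of `T`, of length `p`, and move this length to the right past `m`
columns: if the column of length `p` and the column to its right, of length `q ≤ p`, are both
aligned at the top, then `p - q` slides turn them into columns of lengths `q` and `p`.
The result is the column of length `p` after the `m`-th exchange. -/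
def movedColumn {n : ℕ} {μ : YoungDiagram} (T : Tableau n μ) (j : ℕ) : ℕ → ℕ → ℕ
  | 0 => fun i => T.val i j
  | m + 1 =>
    let l := j + (m + 1)
    (slides (movedColumn T j m) (fun i => T.val i l) (μ.colLen l)
      (μ.colLen j - μ.colLen l)).2

/-- The right key of `T`, as a filling of the cells of `μ`.  Its column `j` is the rightmost column
of the skew tableau that jeu de taquin produces from `T` when the columns `j, j + 1, …` are
exchanged until the length of column `j` is the length of the rightmost column. -/
def rightKey {n : ℕ} {μ : YoungDiagram} (T : Tableau n μ) (i j : ℕ) : ℕ :=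
  movedColumn T j (μ.rowLen 0 - 1 - j) i

/-- The Demazure generating set of `μ` and `w`: the tableaux whose right key is at most the
`μ`-key of `w` in every cell. -/
def demazureSet {n : ℕ} (μ : YoungDiagram) (w : Equiv.Perm (Fin n)) : Set (Tableau n μ) :=
  {T | ∀ i j, (i, j) ∈ μ → rightKey T i j ≤ keyOfPerm μ w i j}

/-! ### The final permutation of the alcove model -/

/-- The permutation whose one-rowed form consists of the values in column `0` of `T` in increasing
order, followed by the other values in increasing order (`Tuple.sort` is stable). -/
def initialPerm {n : ℕ} {μ : YoungDiagram} (T : Tableau n μ) : Equiv.Perm (Fin n) :=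
  Tuple.sort fun x : Fin n =>
    if (x : ℕ) ∈ (Finset.range (μ.colLen 0)).image (fun i => T.val i 0) then (0 : ℕ) else 1

/-- The greedy algorithm at position `a`, with target value `t`: find the smallest position `k ≥ c`
with `π a < π k ≤ t`, interchange the entries at `a` and `k`, and repeat until there is no such
position.  After each interchange the entry at `a` is the last chosen entry, and the chosen entries
increase, so that an entry which was moved is never chosen again, and the result is the cyclic shift
of the chosen entries.  The entry at `a` increases with every interchange, hence there are fewer
than `n` of them. -/
def greedy {n : ℕ} (c t : ℕ) (a : Fin n) : ℕ → Equiv.Perm (Fin n) → Equiv.Perm (Fin n)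
  | 0, π => π
  | fuel + 1, π =>
    match (List.finRange n).find?
      (fun k : Fin n => decide (c ≤ (k : ℕ) ∧ π a < π k ∧ (π k : ℕ) ≤ t)) with
    | none => π
    | some k => greedy c t a fuel (π * Equiv.swap a k)

/-- The greedy algorithm is executed at the cells of column `j` from the bottom to the top (a right
fold treats the last row first). -/
def greedyColumn {n : ℕ} {μ : YoungDiagram} (T : Tableau n μ) (j : ℕ) (π : Equiv.Perm (Fin n)) :
    Equiv.Perm (Fin n) :=
  ((List.finRange n).filter (fun i : Fin n => decide ((i : ℕ) < μ.colLen j))).foldr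
    (fun (i : Fin n) σ => greedy (μ.colLen j) (T.val i j) i n σ) π

/-- The permutation obtained after the top cell of column `j`. -/
def columnPerm {n : ℕ} {μ : YoungDiagram} (T : Tableau n μ) : ℕ → Equiv.Perm (Fin n)
  | 0 => initialPerm T
  | j + 1 => greedyColumn T (j + 1) (columnPerm T j)

/-- The final permutation, obtained after the top cell of the rightmost column. -/
def finalPerm {n : ℕ} {μ : YoungDiagram} (T : Tableau n μ) : Equiv.Perm (Fin n) :=
  columnPerm T (μ.rowLen 0 - 1)

end Demazure

namespace Demazure

/-! Both conditions are comparisons of counts. A finite set of values is encoded by the function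
sending `v` to the number of its members that are at least `v`. Increasing columns compare entry by
entry exactly when these functions do (`le_iff_entriesGE_le`), and the Bruhat order compares them
for the sets of the first `c` entries of two permutations (`rankGE`). By `bruhatLE_iff_of_descents`
it suffices to take those `c` at which the smaller permutation may descend; for the final
permutation these are column lengths (`columnPerm_spec`).

It remains to see that the first `μ.colLen j` entries of the final permutation form, as a set,
column `j` of the right key. Both sets arise by passing the columns to the right of column `j` one
at a time, and both obey the same rule: if `F` counts the current set and `G` the next column, the
new count at `v` is the maximum of `F u + G v - G u` over `u ≥ v`. For jeu de taquin this is
`isMergeCount_slides`, since the maximum is invariant under single slides. For the greedy algorithm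
it is `foldr_greedy_column`, where the column is added one entry at a time from the bottom. The rule
determines the result, and `rankGE_columnPerm` follows by induction. -/

/-! ### Counting functions of columns and the merging rule -/

/-- The number of rows `i ∈ [k, p)` in which the column `R` has an entry that is at least `v`. -/
def entriesGE (R : ℕ → ℕ) (k p v : ℕ) : ℕ := ((Finset.Ico k p).filter (fun i => v ≤ R i)).card

/-- `M v` is the maximum of `F u + G v - G u` over all `u ≥ v`. -/
def IsMergeCount (F G M : ℕ → ℕ) : Prop :=
  ∀ v, (∀ u, v ≤ u → F u + G v ≤ M v + G u) ∧ ∃ u, v ≤ u ∧ M v + G u = F u + G v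

lemma IsMergeCount.unique {F G M M' : ℕ → ℕ} (h : IsMergeCount F G M) (h' : IsMergeCount F G M')
    (v : ℕ) : M v = M' v := by
  obtain ⟨h1, u, hu, h2⟩ := h v
  obtain ⟨h3, u', hu', h4⟩ := h' v
  have := h1 u' hu'
  have := h3 u hu
  omega

lemma entriesGE_split (R : ℕ → ℕ) (k p : ℕ) {x u : ℕ} (h : x ≤ u) :
    entriesGE R k p x = entriesGE R k p u +
      ((Finset.Ico k p).filter (fun i => x ≤ R i ∧ R i < u)).card := by
  unfold entriesGE
  rw [← Finset.card_union_of_disjoint]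
  · congr 1
    ext i
    simp only [Finset.mem_filter, Finset.mem_union]
    constructor
    · rintro ⟨h1, h2⟩
      by_cases h3 : u ≤ R i
      · exact Or.inl ⟨h1, h3⟩
      · exact Or.inr ⟨h1, h2, by omega⟩
    · rintro (⟨h1, h2⟩ | ⟨h1, h2, h3⟩)
      · exact ⟨h1, by omega⟩
      · exact ⟨h1, h2⟩
  · rw [Finset.disjoint_left]
    intro i
    simp only [Finset.mem_filter]
    omega

/-- In an increasing column the entries that are at least `v` fill a final segment of the rows, so
its length tells which rows they are. -/
lemma le_iff_entriesGE {R : ℕ → ℕ} {p : ℕ} (hR : StrictMonoOn R (Set.Iio p)) {i : ℕ} (hi : i < p)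
    (v : ℕ) : v ≤ R i ↔ p - i ≤ entriesGE R 0 p v := by
  unfold entriesGE
  constructor
  · intro h
    rw [← Nat.card_Ico]
    apply Finset.card_le_card
    intro k hk
    simp only [Finset.mem_Ico, Finset.mem_filter] at hk ⊢
    exact ⟨by omega, h.trans (hR.monotoneOn hi hk.2 hk.1)⟩
  · intro h
    by_contra hv
    have : ((Finset.Ico 0 p).filter (fun i => v ≤ R i)).card ≤ (Finset.Ico (i + 1) p).card := by
      apply Finset.card_le_card
      intro k hk
      simp only [Finset.mem_Ico, Finset.mem_filter] at hk ⊢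
      refine ⟨?_, hk.1.2⟩
      by_contra hki
      have := hR.monotoneOn (a := k) (b := i) hk.1.2 hi (by omega)
      omega
    rw [Nat.card_Ico] at this
    omega

lemma le_iff_entriesGE_le {R R' : ℕ → ℕ} {p : ℕ} (hR : StrictMonoOn R (Set.Iio p))
    (hR' : StrictMonoOn R' (Set.Iio p)) :
    (∀ i < p, R i ≤ R' i) ↔ ∀ v, entriesGE R 0 p v ≤ entriesGE R' 0 p v := by
  constructor
  · intro h v
    apply Finset.card_le_card
    intro i hi
    simp only [Finset.mem_Ico, Finset.mem_filter] at hi ⊢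
    exact ⟨hi.1, hi.2.trans (h i hi.1.2)⟩
  · intro h i hi
    rw [le_iff_entriesGE hR' hi]
    exact ((le_iff_entriesGE hR hi _).1 le_rfl).trans (h _)

/-! ### Slides of jeu de taquin -/

lemma slideRow_le (L R : ℕ → ℕ) (q : ℕ) : slideRow L R q ≤ q := by
  induction q with
  | zero => simp [slideRow]
  | succ r ih =>
    rw [slideRow]
    split_ifs <;> omega

lemma slideRow_stop (L R : ℕ → ℕ) (q s : ℕ) (h : slideRow L R q = s + 1) : R s < L (s + 1) := by
  induction q with
  | zero => simp [slideRow] at h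
  | succ r ih =>
    rw [slideRow] at h
    split_ifs at h with h1
    · obtain rfl : r = s := by omega
      exact h1
    · exact ih h

lemma le_of_slideRow_lt (L R : ℕ → ℕ) (q i : ℕ) (h : slideRow L R q < i + 1) (hi : i + 1 ≤ q) :
    L (i + 1) ≤ R i := by
  induction q with
  | zero => omega
  | succ r ih =>
    rw [slideRow] at h
    split_ifs at h with h1
    · omega
    · rcases Nat.lt_or_ge i r with h2 | h2
      · exact ih h (by omega)
      · obtain rfl : i = r := by omega
        omega

lemma le_slideRow (L R : ℕ → ℕ) (q i : ℕ) (h : R i < L (i + 1)) (hi : i + 1 ≤ q) :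
    i + 1 ≤ slideRow L R q := by
  by_contra h1
  have := le_of_slideRow_lt L R q i (by omega) hi
  omega

/-- The columns `L`, in rows `k, …, p - 1`, and `R`, in rows `0, …, q + k - 1`, form a skew
tableau that arises after `k` slides. -/
structure SlideState (p q k : ℕ) (L R : ℕ → ℕ) : Prop where
  left : StrictMonoOn L (Set.Ico k p)
  right : StrictMonoOn R (Set.Iio (q + k))
  row : ∀ i, k ≤ i → i < q + k → L i ≤ R i
  -- The empty box does not rise above the top of the left column, so the next slide stays inside
  -- the skew shape.
  start : q + k < p → k ≤ slideRow L R (q + k)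

lemma SlideState.lt_of_lt_slideRow {p q k : ℕ} {L R : ℕ → ℕ} (h : SlideState p q k L R)
    {i : ℕ} (hi : i < slideRow L R (q + k)) : R i < L (slideRow L R (q + k)) := by
  obtain ⟨s, hs⟩ : ∃ s, slideRow L R (q + k) = s + 1 := ⟨_, (Nat.succ_pred (by omega)).symm⟩
  have h1 := slideRow_stop L R _ s hs
  have h2 := slideRow_le L R (q + k)
  rw [hs] at hi h2 ⊢
  exact (h.right.monotoneOn (a := i) (b := s) (by simp only [Set.mem_Iio]; omega)
    (by simp only [Set.mem_Iio]; omega) (by omega)).trans_lt h1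

lemma SlideState.slide {p q k : ℕ} {L R : ℕ → ℕ} (h : SlideState p q k L R) (hp : q + k < p) :
    SlideState p q (k + 1) (slide L R (q + k)).1 (slide L R (q + k)).2 := by
  have hlt := fun i => h.lt_of_lt_slideRow (i := i)
  have hle := slideRow_le L R (q + k)
  have hge := fun i => le_of_slideRow_lt L R (q + k) i
  have hk := h.start hp
  unfold Demazure.slide
  generalize slideRow L R (q + k) = s at *
  have hL : ∀ i j, k ≤ i → j < p → i < j → L i < L j := fun i j hi hj hij =>
    h.left ⟨hi, by omega⟩ ⟨by omega, hj⟩ hij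
  have hR : ∀ i j, j < q + k → i < j → R i < R j := fun i j hj hij =>
    h.right (show i < q + k by omega) hj hij
  have hrow := h.row
  refine ⟨?_, ?_, ?_, ?_⟩
  · rintro i ⟨hi, hi'⟩ j ⟨hj, hj'⟩ hij
    dsimp only
    split_ifs <;> first | omega | (apply hL <;> omega)
  · rintro i hi j hj hij
    simp only [Set.mem_Iio] at hi hj
    dsimp only
    by_cases h1 : j < s
    · rw [if_pos (by omega), if_pos h1]
      exact hR _ _ (by omega) hij
    by_cases h2 : j = s
    · rw [if_pos (by omega), if_neg h1, if_pos h2]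
      exact hlt i (by omega)
    rw [if_neg h1, if_neg h2]
    by_cases h3 : i < s
    · rw [if_pos h3]
      exact hR _ _ (by omega) (by omega)
    rw [if_neg h3]
    split_ifs with h4
    · subst h4
      have h5 := hge (j - 1) (by omega) (by omega)
      have h6 := hL i (j - 1 + 1) (by omega) (by omega) (by omega)
      omega
    · exact hR _ _ (by omega) (by omega)
  · intro i hi hi'
    dsimp only
    by_cases h1 : i < s
    · rw [if_pos (by omega), if_pos h1]
      exact (hL _ _ (by omega) (by omega) (by omega)).le.trans (hrow i (by omega) (by omega))
    by_cases h2 : i = s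
    · rw [if_pos (by omega), if_neg h1, if_pos h2]
      subst h2
      exact (hL _ _ (by omega) (by omega) (by omega)).le
    rw [if_neg (by omega), if_neg h1, if_neg h2]
    have h5 := hge (i - 1) (by omega) (by omega)
    rwa [Nat.sub_add_cancel (by omega)] at h5
  · intro hp'
    -- The entry `L s` that crossed now stands in row `s` of the right column. It is smaller than `L
    -- (s + 1)`, so the next slide crosses in row `s + 1` or below.
    refine le_trans (show k + 1 ≤ s + 1 by omega) (le_slideRow _ _ _ _ ?_ (by omega))
    simp only [lt_irrefl, if_false, if_true]
    rw [if_neg (by omega)]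
    exact hL _ _ (by omega) (by omega) (by omega)

/-- This keeps the moved column weakly below the column that it has passed, hence below the next
column of the tableau, as the next exchange requires. -/
lemma slide_right_le {p q k : ℕ} {L R : ℕ → ℕ} (h : SlideState p q k L R) (hp : q + k < p)
    (i : ℕ) (hi : i < q + k) : (slide L R (q + k)).2 i ≤ R i := by
  have hk := h.start hp
  unfold slide
  dsimp only
  generalize slideRow L R (q + k) = s at *
  split_ifs with h1 h2
  · exact le_rfl
  · subst h2
    exact h.row _ hk hi
  · exact (h.right (show i - 1 < q + k by omega) hi (by omega)).le

lemma entriesGE_slide_right (L R : ℕ → ℕ) (q v : ℕ) :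
    entriesGE (slide L R q).2 0 (q + 1) v =
      entriesGE R 0 q v + if v ≤ L (slideRow L R q) then 1 else 0 := by
  have hle := slideRow_le L R q
  unfold slide entriesGE
  dsimp only
  generalize slideRow L R q = s at *
  simp only [Finset.card_filter, Nat.Ico_zero_eq_range]
  rw [← Finset.sum_range_add_sum_Ico _ (show s ≤ q + 1 by omega),
    ← Finset.sum_range_add_sum_Ico _ (show s ≤ q by omega), add_assoc]
  congr 1
  · refine Finset.sum_congr rfl fun i hi => ?_
    refine if_congr ?_ rfl rfl
    rw [if_pos (Finset.mem_range.1 hi)]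
  · rw [Finset.sum_eq_sum_Ico_succ_bot (by omega), add_comm]
    simp only [lt_irrefl, if_false, if_true]
    congr 1
    rw [← Finset.sum_Ico_add' _ s q 1]
    refine Finset.sum_congr rfl fun i hi => ?_
    have := (Finset.mem_Ico.1 hi).1
    refine if_congr ?_ rfl rfl
    rw [if_neg (by omega), if_neg (by omega), Nat.add_sub_cancel]

lemma entriesGE_slide_left (L R : ℕ → ℕ) {k p q : ℕ} (hk : k ≤ slideRow L R q)
    (hp : slideRow L R q < p) (v : ℕ) :
    entriesGE L k p v = entriesGE (slide L R q).1 (k + 1) p v +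
      if v ≤ L (slideRow L R q) then 1 else 0 := by
  unfold slide entriesGE
  dsimp only
  generalize slideRow L R q = s at *
  simp only [Finset.card_filter]
  rw [← Finset.sum_Ico_consecutive _ hk hp.le,
    ← Finset.sum_Ico_consecutive _ (show k + 1 ≤ s + 1 by omega) (show s + 1 ≤ p by omega),
    Finset.sum_eq_sum_Ico_succ_bot hp, add_assoc]
  congr 1
  · rw [← Finset.sum_Ico_add' _ k s 1]
    refine Finset.sum_congr rfl fun i hi => ?_
    have := (Finset.mem_Ico.1 hi).2
    refine if_congr ?_ rfl rfl
    rw [if_pos (by omega), Nat.add_sub_cancel]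
  · rw [add_comm]
    congr 1
    refine Finset.sum_congr rfl fun i hi => ?_
    have := (Finset.mem_Ico.1 hi).1
    refine if_congr ?_ rfl rfl
    rw [if_neg (by omega)]

/-- A slide only transfers the value `x = L s` from left to right. In `F u + G v - G u` nothing
changes for `v > x`; for `v ≤ x` the terms with `u ≤ x` drop by 1 and those with `u > x` rise by 1.
The maximum survives because before the slide the best term with `u ≤ x` exceeds the best one with
`u > x` by exactly 1: `hA` and `hB` give the two inequalities. -/
lemma SlideState.isMergeCount {p q k : ℕ} {L R : ℕ → ℕ} (h : SlideState p q k L R)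
    (hp : q + k < p) {M : ℕ → ℕ}
    (hM : IsMergeCount (entriesGE (Demazure.slide L R (q + k)).1 (k + 1) p)
      (entriesGE (Demazure.slide L R (q + k)).2 0 (q + k + 1)) M) :
    IsMergeCount (entriesGE L k p) (entriesGE R 0 (q + k)) M := by
  have hk := h.start hp
  have hlt := fun i => h.lt_of_lt_slideRow (i := i)
  have hle := slideRow_le L R (q + k)
  have hge := fun i => le_of_slideRow_lt L R (q + k) i
  have hF := entriesGE_slide_left L R hk (by omega : _ < p)
  have hG := entriesGE_slide_right L R (q + k)
  generalize hF' : entriesGE (Demazure.slide L R (q + k)).1 (k + 1) p = F' at *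
  generalize hG' : entriesGE (Demazure.slide L R (q + k)).2 0 (q + k + 1) = G' at *
  generalize slideRow L R (q + k) = s at *
  have hsL : ∀ i, k ≤ i → i < p → (L s < L i ↔ s < i) := fun i hi hi' =>
    h.left.lt_iff_lt ⟨hk, by omega⟩ ⟨hi, hi'⟩
  -- Row `i ↦ i + 1` injects the entries of `R` in `[L s, u)` into those of `L`, because `L (i + 1)
  -- ≤ R i` below the crossing row; row `s` itself is missed, which gives the extra 1.
  have hA : ∀ u, L s < u → entriesGE L k p u + entriesGE R 0 (q + k) (L s) + 1 ≤
      entriesGE L k p (L s) + entriesGE R 0 (q + k) u := by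
    intro u hu
    rw [entriesGE_split L k p hu.le, entriesGE_split R 0 (q + k) hu.le]
    have hs : s ∉ ((Finset.Ico 0 (q + k)).filter (fun i => L s ≤ R i ∧ R i < u)).map
        (addRightEmbedding 1) := by
      simp only [Finset.mem_map, Finset.mem_filter, addRightEmbedding_apply, not_exists, not_and]
      rintro i ⟨_, h2, _⟩ rfl
      have := hlt i (by omega)
      omega
    have : (insert s (((Finset.Ico 0 (q + k)).filter (fun i => L s ≤ R i ∧ R i < u)).map
        (addRightEmbedding 1))).card ≤
        ((Finset.Ico k p).filter (fun i => L s ≤ L i ∧ L i < u)).card := by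
      apply Finset.card_le_card
      intro j hj
      simp only [Finset.mem_insert, Finset.mem_map, Finset.mem_filter, addRightEmbedding_apply,
        Finset.mem_Ico] at hj ⊢
      rcases hj with rfl | ⟨i, ⟨h1, h2, h3⟩, rfl⟩
      · exact ⟨⟨hk, by omega⟩, le_rfl, hu⟩
      · have h4 : s ≤ i := by
          by_contra h5
          have := hlt i (by omega)
          omega
        refine ⟨⟨by omega, by omega⟩, ((hsL (i + 1) (by omega) (by omega)).2 (by omega)).le, ?_⟩
        exact (hge i (by omega) (by omega)).trans_lt h3
    rw [Finset.card_insert_of_notMem hs, Finset.card_map] at this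
    omega
  -- An entry of `L` in `[w, L s]` outside row `s` lies above it, and its right neighbour lies in
  -- the same interval.
  have hB : ∀ w, w ≤ L s → entriesGE L k p w + entriesGE R 0 (q + k) (L s + 1) ≤
      entriesGE L k p (L s + 1) + entriesGE R 0 (q + k) w + 1 := by
    intro w hw
    rw [entriesGE_split L k p (show w ≤ L s + 1 by omega),
      entriesGE_split R 0 (q + k) (show w ≤ L s + 1 by omega)]
    have : ((Finset.Ico k p).filter (fun i => w ≤ L i ∧ L i < L s + 1)).card ≤
        (insert s ((Finset.Ico 0 (q + k)).filter (fun i => w ≤ R i ∧ R i < L s + 1))).card := by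
      apply Finset.card_le_card
      intro i hi
      simp only [Finset.mem_insert, Finset.mem_filter, Finset.mem_Ico] at hi ⊢
      obtain ⟨⟨h1, h2⟩, h3, h4⟩ := hi
      have h5 := hsL i h1 h2
      by_cases h6 : i = s
      · exact Or.inl h6
      · have h7 := hlt i (by omega)
        have h8 := h.row i h1 (by omega)
        exact Or.inr ⟨by omega, by omega, by omega⟩
    have := this.trans (Finset.card_insert_le _ _)
    omega
  generalize entriesGE L k p = F at *
  generalize entriesGE R 0 (q + k) = G at *
  generalize L s = x at *
  intro v
  obtain ⟨h1, u0, hu0, h2⟩ := hM v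
  have key : ∀ u, v ≤ u → F u + G v ≤ M v + G u := by
    intro u hu
    have h3 := h1 u hu
    rw [hG v, hG u] at h3
    rw [hF u]
    by_cases hux : u ≤ x
    · have h4 := hB u hux
      have h5 := h1 (x + 1) (by omega)
      have h6 := hF (x + 1)
      have h7 := hF u
      rw [hG v, hG (x + 1)] at h5
      split_ifs at * <;> omega
    · split_ifs at * <;> omega
  refine ⟨key, ?_⟩
  have h3 := key u0 hu0
  have h4 := hF u0
  rw [hG v, hG u0] at h2
  by_cases hvx : v ≤ x
  · by_cases hux : u0 ≤ x
    · exact ⟨u0, hu0, by split_ifs at * ; all_goals omega⟩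
    · have h5 := hA u0 (by omega)
      have h6 := key x hvx
      exact ⟨x, hvx, by split_ifs at * ; all_goals omega⟩
  · exact ⟨u0, hu0, by split_ifs at * ; all_goals omega⟩

lemma SlideState.slides {p q : ℕ} {L R : ℕ → ℕ} (h : SlideState p q 0 L R) (k : ℕ)
    (hk : q + k ≤ p) : SlideState p q k (slides L R q k).1 (slides L R q k).2 := by
  induction k with
  | zero => exact h
  | succ k ih => exact (ih (by omega)).slide (by omega)

lemma slides_right_le {p q : ℕ} {L R : ℕ → ℕ} (h : SlideState p q 0 L R) (k : ℕ)
    (hk : q + k ≤ p) (i : ℕ) (hi : i < q) : (slides L R q k).2 i ≤ R i := by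
  induction k with
  | zero => exact le_rfl
  | succ k ih =>
    exact (slide_right_le (h.slides k (by omega)) (by omega) i (by omega)).trans (ih (by omega))

lemma isMergeCount_of_slides {p q : ℕ} {L R : ℕ → ℕ} (h : SlideState p q 0 L R) (k : ℕ)
    (hk : q + k ≤ p) {M : ℕ → ℕ}
    (hM : IsMergeCount (entriesGE (slides L R q k).1 k p)
      (entriesGE (slides L R q k).2 0 (q + k)) M) :
    IsMergeCount (entriesGE L 0 p) (entriesGE R 0 q) M := by
  induction k with
  | zero => exact hM
  | succ k ih => exact ih (by omega) ((h.slides k (by omega)).isMergeCount (by omega) hM)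

lemma slideState_zero {p q : ℕ} {L R : ℕ → ℕ} (hL : StrictMonoOn L (Set.Iio p))
    (hR : StrictMonoOn R (Set.Iio q)) (hLR : ∀ i < q, L i ≤ R i) : SlideState p q 0 L R :=
  ⟨hL.mono fun _ hi => hi.2, hR, fun i _ hi => hLR i hi, fun _ => Nat.zero_le _⟩

lemma isMergeCount_slides {p q : ℕ} {L R : ℕ → ℕ} (h : SlideState p q 0 L R) (hq : q ≤ p) :
    IsMergeCount (entriesGE L 0 p) (entriesGE R 0 q) (entriesGE (slides L R q (p - q)).2 0 p) := by
  have hs := h.slides (p - q) (by omega)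
  refine isMergeCount_of_slides h (p - q) (by omega) ?_
  rw [Nat.add_sub_cancel' hq]
  generalize (slides L R q (p - q)).1 = L' at *
  generalize (slides L R q (p - q)).2 = R' at *
  have hrow := hs.row
  have hle : ∀ u, entriesGE L' (p - q) p u ≤ entriesGE R' 0 p u := by
    intro u
    apply Finset.card_le_card
    intro i hi
    simp only [Finset.mem_filter, Finset.mem_Ico] at hi ⊢
    exact ⟨by omega, hi.2.trans (hrow i hi.1.1 (by omega))⟩
  intro v
  refine ⟨fun u _ => by have := hle u; omega, ?_⟩
  have hzero : ∀ (f : ℕ → ℕ) (k : ℕ), ∃ B, ∀ u, B ≤ u → entriesGE f k p u = 0 := by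
    intro f k
    refine ⟨(Finset.Ico k p).sup f + 1, fun u hu => ?_⟩
    unfold entriesGE
    rw [Finset.card_eq_zero, Finset.filter_eq_empty_iff]
    intro i hi
    have : f i ≤ (Finset.Ico k p).sup f := Finset.le_sup hi
    omega
  obtain ⟨B, hB⟩ := hzero L' (p - q)
  obtain ⟨B', hB'⟩ := hzero R' 0
  -- Beyond all entries both counts vanish. Since the remaining left column is dominated row by row,
  -- the maximum is attained there and equals the count of the right column.
  refine ⟨v + B + B', by omega, ?_⟩
  rw [hB (v + B + B') (by omega), hB' (v + B + B') (by omega)]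
  omega

/-! ### Rank functions of permutations -/

/-- The number of positions `k < c` with `π k ≥ v`. -/
def rankGE {n : ℕ} (π : Equiv.Perm (Fin n)) (c v : ℕ) : ℕ :=
  (Finset.univ.filter (fun k : Fin n => (k : ℕ) < c ∧ v ≤ (π k : ℕ))).card

lemma rankGE_mul_swap {n : ℕ} (π : Equiv.Perm (Fin n)) {a b : Fin n} (hab : a < b)
    (hπ : π a < π b) (c v : ℕ) :
    rankGE (π * Equiv.swap a b) c v = rankGE π c v +
      if ((a : ℕ) < c ∧ c ≤ b) ∧ ((π a : ℕ) < v ∧ v ≤ π b) then 1 else 0 := by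
  unfold rankGE
  simp only [Finset.card_filter]
  have ha : a ∈ (Finset.univ : Finset (Fin n)) := Finset.mem_univ a
  have hb : b ∈ Finset.univ.erase a := Finset.mem_erase.2 ⟨hab.ne', Finset.mem_univ b⟩
  rw [← Finset.add_sum_erase _ _ ha, ← Finset.add_sum_erase _ _ hb,
    ← Finset.add_sum_erase (a := a) _ _ ha, ← Finset.add_sum_erase (a := b) _ _ hb]
  have hrest : ∑ k ∈ (Finset.univ.erase a).erase b,
      (if (k : ℕ) < c ∧ v ≤ ((π * Equiv.swap a b) k : ℕ) then 1 else 0) =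
      ∑ k ∈ (Finset.univ.erase a).erase b, if (k : ℕ) < c ∧ v ≤ (π k : ℕ) then 1 else 0 := by
    refine Finset.sum_congr rfl fun k hk => ?_
    simp only [Finset.mem_erase] at hk
    rw [Equiv.Perm.mul_apply, Equiv.swap_apply_of_ne_of_ne hk.2.1 hk.1]
  rw [hrest]
  simp only [Equiv.Perm.mul_apply, Equiv.swap_apply_left, Equiv.swap_apply_right]
  have h1 : (a : ℕ) < b := hab
  have h2 : (π a : ℕ) < π b := hπ
  split_ifs <;> omega

lemma rankGE_eq_entriesGE {n : ℕ} (π : Equiv.Perm (Fin n)) {c : ℕ} (hc : c ≤ n) {R : ℕ → ℕ}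
    (h : ∀ k : Fin n, (k : ℕ) < c → (π k : ℕ) = R k) (v : ℕ) :
    rankGE π c v = entriesGE R 0 c v := by
  unfold rankGE entriesGE
  refine Finset.card_bij (fun k _ => (k : ℕ)) ?_ ?_ ?_
  · intro k hk
    simp only [Finset.mem_filter, Finset.mem_Ico, Finset.mem_univ, true_and] at hk ⊢
    exact ⟨⟨by omega, hk.1⟩, by rw [← h k hk.1]; exact hk.2⟩
  · intro k _ l _ hkl
    exact Fin.ext hkl
  · intro i hi
    simp only [Finset.mem_filter, Finset.mem_Ico] at hi
    refine ⟨⟨i, by omega⟩, ?_, rfl⟩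
    simp only [Finset.mem_filter, Finset.mem_univ, true_and]
    refine ⟨hi.1.2, ?_⟩
    rw [h ⟨i, by omega⟩ hi.1.2]
    exact hi.2

lemma rankGE_mono_left {n : ℕ} (π : Equiv.Perm (Fin n)) {c d : ℕ} (h : c ≤ d) (v : ℕ) :
    rankGE π c v ≤ rankGE π d v := by
  apply Finset.card_le_card
  intro k hk
  simp only [Finset.mem_filter, Finset.mem_univ, true_and] at hk ⊢
  exact ⟨by omega, hk.2⟩

lemma rankGE_anti {n : ℕ} (π : Equiv.Perm (Fin n)) (c : ℕ) {u v : ℕ} (h : u ≤ v) :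
    rankGE π c v ≤ rankGE π c u := by
  apply Finset.card_le_card
  intro k hk
  simp only [Finset.mem_filter, Finset.mem_univ, true_and] at hk ⊢
  exact ⟨hk.1, by omega⟩

lemma rankGE_succ {n : ℕ} (π : Equiv.Perm (Fin n)) (a : Fin n) (v : ℕ) :
    rankGE π (a + 1) v = rankGE π a v + if v ≤ (π a : ℕ) then 1 else 0 := by
  unfold rankGE
  simp only [Finset.card_filter]
  have ha : a ∈ (Finset.univ : Finset (Fin n)) := Finset.mem_univ a
  rw [← Finset.add_sum_erase _ _ ha, ← Finset.add_sum_erase (a := a) _ _ ha]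
  have hrest : ∑ k ∈ Finset.univ.erase a, (if (k : ℕ) < a + 1 ∧ v ≤ (π k : ℕ) then 1 else 0) =
      ∑ k ∈ Finset.univ.erase a, if (k : ℕ) < a ∧ v ≤ (π k : ℕ) then 1 else 0 := by
    refine Finset.sum_congr rfl fun k hk => if_congr ?_ rfl rfl
    have : (k : ℕ) ≠ a := fun h => (Finset.mem_erase.1 hk).1 (Fin.ext h)
    omega
  rw [hrest]
  split_ifs <;> omega

lemma rankGE_eq_of_forall_notMem {n : ℕ} (π : Equiv.Perm (Fin n)) (c : ℕ) {v t : ℕ} (hv : v ≤ t)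
    (h : ∀ k : Fin n, (k : ℕ) < c → ¬ (v ≤ (π k : ℕ) ∧ (π k : ℕ) < t)) :
    rankGE π c v = rankGE π c t := by
  unfold rankGE
  congr 1
  ext k
  simp only [Finset.mem_filter, Finset.mem_univ, true_and]
  have := h k
  omega

lemma lt_rankGE {n : ℕ} (π : Equiv.Perm (Fin n)) {c : ℕ} {v t : ℕ} (a : Fin n)
    (ha : (a : ℕ) < c) (hv : v ≤ (π a : ℕ)) (ht : (π a : ℕ) < t) :
    rankGE π c t < rankGE π c v := by
  apply Finset.card_lt_card
  rw [Finset.ssubset_iff_of_subset]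
  · refine ⟨a, ?_, ?_⟩ <;> simp only [Finset.mem_filter, Finset.mem_univ, true_and] <;> omega
  · intro k hk
    simp only [Finset.mem_filter, Finset.mem_univ, true_and] at hk ⊢
    exact ⟨hk.1, by omega⟩

/-! ### The greedy algorithm -/

/-- The effect of the greedy algorithm from position `a` with target `t` on a permutation. -/
structure IsGreedyStep {n : ℕ} (c t : ℕ) (a : Fin n) (π σ : Equiv.Perm (Fin n)) : Prop where
  apply_self : (σ a : ℕ) = t
  apply_of_lt : ∀ k : Fin n, (k : ℕ) < c → k ≠ a → σ k = π k
  ascent : ∀ x y : Fin n, c ≤ (x : ℕ) → (y : ℕ) = x + 1 → π x < π y → σ x < σ y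
  rank : ∀ d v, c ≤ d → rankGE σ d v =
    if v ≤ t then max (rankGE π d v) (1 + rankGE π d (t + 1)) else rankGE π d v

/-- Every interchange raises the entry at `a`, which is why the fuel suffices. By `h` no other
position before `c` holds a value between `π a` and `t`, so the search from `c` on misses nothing.
-/
lemma isGreedyStep_greedy {n : ℕ} {c t : ℕ} (ht : t < n) {a : Fin n} (ha : (a : ℕ) < c)
    (fuel : ℕ) (π : Equiv.Perm (Fin n)) (hle : (π a : ℕ) ≤ t) (hfuel : t < π a + fuel)
    (h : ∀ k : Fin n, (k : ℕ) < c → k ≠ a → π k < π a ∨ t < π k) :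
    IsGreedyStep c t a π (greedy c t a fuel π) := by
  induction fuel generalizing π with
  | zero => omega
  | succ fuel ih =>
    rw [greedy]
    split
    · rename_i hnone
      rw [List.find?_eq_none] at hnone
      simp only [List.mem_finRange, decide_eq_true_eq, forall_const] at hnone
      have hat : (π a : ℕ) = t := by
        by_contra hne
        set k := π.symm ⟨t, ht⟩ with hk
        have hπk : (π k : ℕ) = t := by rw [hk, Equiv.apply_symm_apply]
        by_cases hkc : (k : ℕ) < c
        · have hka : k ≠ a := by
            intro h1
            rw [h1] at hπk
            exact hne hπk
          have := h k hkc hka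
          rw [Fin.lt_def] at this
          omega
        · exact hnone k ⟨by omega, by rw [Fin.lt_def]; omega, by omega⟩
      refine ⟨hat, fun _ _ _ => rfl, fun _ _ _ _ h => h, fun d v hd => ?_⟩
      split_ifs with hv
      · have := lt_rankGE π (c := d) (v := v) (t := t + 1) a (by omega) (by omega) (by omega)
        omega
      · rfl
    · rename_i k hk
      rw [List.find?_eq_some_iff_append] at hk
      obtain ⟨hk1, l₁, l₂, hl, hl₁⟩ := hk
      simp only [decide_eq_true_eq] at hk1
      obtain ⟨hck, hak, hkt⟩ := hk1
      have hfirst : ∀ x : Fin n, x < k → c ≤ (x : ℕ) → π a < π x → t < π x := by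
        intro x hx hcx hax
        by_contra hxt
        have hxl : x ∈ l₁ := by
          have hmem := List.mem_finRange x
          rw [hl, List.mem_append, List.mem_cons] at hmem
          rcases hmem with h1 | rfl | h1
          · exact h1
          · exact absurd hx (lt_irrefl _)
          · have hs := List.pairwise_lt_finRange n
            rw [hl, List.pairwise_append] at hs
            exact absurd ((List.pairwise_cons.1 hs.2.1).1 x h1) hx.asymm
        have := hl₁ x hxl
        simp only [Bool.not_eq_true', decide_eq_false_iff_not] at this
        exact this ⟨hcx, hax, by omega⟩
      have hltak : a < k := by rw [Fin.lt_def]; omega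
      have hself : (π * Equiv.swap a k) a = π k := by
        rw [Equiv.Perm.mul_apply, Equiv.swap_apply_left]
      have hk' : (π * Equiv.swap a k) k = π a := by
        rw [Equiv.Perm.mul_apply, Equiv.swap_apply_right]
      have hother : ∀ x, x ≠ a → x ≠ k → (π * Equiv.swap a k) x = π x := by
        intro x hxa hxk
        rw [Equiv.Perm.mul_apply, Equiv.swap_apply_of_ne_of_ne hxa hxk]
      have hltc : ∀ x : Fin n, (x : ℕ) < c → x ≠ a → (π * Equiv.swap a k) x = π x := by
        intro x hx hxa
        refine hother x hxa ?_
        rintro rfl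
        omega
      have hih := ih (π * Equiv.swap a k) (by rw [hself]; exact hkt)
        (by rw [hself]; rw [Fin.lt_def] at hak; omega) (by
          intro x hx hxa
          rw [hltc x hx hxa, hself]
          rcases h x hx hxa with h1 | h1
          · exact Or.inl (h1.trans hak)
          · exact Or.inr h1)
      refine ⟨hih.apply_self, fun x hx hxa => by rw [hih.apply_of_lt x hx hxa, hltc x hx hxa],
        fun x y hx hy hxy => hih.ascent x y hx hy ?_, fun d v hd => ?_⟩
      · have hxa : x ≠ a := by rintro rfl; omega
        have hya : y ≠ a := by rintro rfl; omega
        by_cases hxk : x = k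
        · subst hxk
          rw [hk', hother y hya (by rintro rfl; omega)]
          exact hak.trans hxy
        · rw [hother x hxa hxk]
          by_cases hyk : y = k
          · subst hyk
            rw [hk']
            -- Otherwise `π x` would lie between `π a` and `π k`, and the search would have chosen
            -- the earlier position `x`.
            by_contra hax
            have hne : π a ≠ π x := fun he => hxa (π.injective he).symm
            have := hfirst x (by rw [Fin.lt_def]; omega) hx (lt_of_le_of_ne (not_lt.1 hax) hne)
            rw [Fin.lt_def] at hxy
            omega
          · rwa [hother y hya hyk]
      · rw [hih.rank d v hd, rankGE_mul_swap π hltak hak, rankGE_mul_swap π hltak hak]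
        rw [if_neg (c := _ ∧ (_ < t + 1 ∧ _)) (by omega), add_zero]
        split_ifs with hv hc
        -- Here the interchange crosses `d`. No position before `d` holds a value in `(π a, t]`, as
        -- `k` is the first candidate, so the count at `v` is the count at `t + 1` before the
        -- interchange and one more after it.
        · have : rankGE π d v = rankGE π d (t + 1) := by
            refine rankGE_eq_of_forall_notMem π d (by omega) ?_
            rintro x hx ⟨h1, h2⟩
            have hxa : x ≠ a := by rintro rfl; omega
            by_cases hxc : (x : ℕ) < c
            · have := h x hxc hxa
              rw [Fin.lt_def] at this
              omega
            · have := hfirst x (by rw [Fin.lt_def]; omega) (by omega) (by rw [Fin.lt_def]; omega)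
              omega
          omega
        · rfl
        · rename_i hc
          omega
        · rfl

lemma isMergeCount_zero {F : ℕ → ℕ} (hF : Antitone F) : IsMergeCount F (fun _ => 0) F :=
  fun v => ⟨fun _ hu => by have := hF hu; omega, v, le_rfl, rfl⟩

/-- The new entry `t` is smaller than all entries counted by `G`. For `v ≤ t` it leaves the terms
with `u ≤ t` alone and adds 1 to those with `u > t`, whose new maximum is `1 + N (t + 1)`. -/
lemma IsMergeCount.step {F G N N' G' : ℕ → ℕ} {t : ℕ} (h : IsMergeCount F G N)
    (hG : ∀ u ≤ t, G u = G (t + 1)) (hG' : ∀ u, G' u = G u + if u ≤ t then 1 else 0)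
    (hN' : ∀ v, N' v = if v ≤ t then max (N v) (1 + N (t + 1)) else N v) :
    IsMergeCount F G' N' := by
  intro v
  obtain ⟨h1, u0, hu0, h2⟩ := h v
  obtain ⟨h3, u1, hu1, h4⟩ := h (t + 1)
  rw [hN', hG']
  by_cases hv : v ≤ t
  · have hGv := hG v hv
    rw [if_pos hv, if_pos hv]
    constructor
    · intro u hu
      rw [hG']
      have h5 := h1 u hu
      by_cases hut : u ≤ t
      · have := hG u hut
        rw [if_pos hut]
        omega
      · have := h3 u (by omega)
        rw [if_neg hut]
        omega
    · by_cases hN : 1 + N (t + 1) ≤ N v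
      · refine ⟨u0, hu0, ?_⟩
        rw [hG']
        by_cases hut : u0 ≤ t
        · rw [if_pos hut]
          omega
        · have := h3 u0 (by omega)
          omega
      · refine ⟨u1, by omega, ?_⟩
        rw [hG', if_neg (by omega)]
        omega
  · rw [if_neg hv, if_neg hv]
    constructor
    · intro u hu
      rw [hG', if_neg (by omega)]
      exact h1 u hu
    · refine ⟨u0, hu0, ?_⟩
      rw [hG', if_neg (by omega)]
      exact h2

/-- The effect of the greedy algorithm at the rows in `l`, a final segment of the rows of a column
of length `c` with entries `R`. -/
lemma foldr_greedy {n c : ℕ} {R : ℕ → ℕ} (hR : StrictMonoOn R (Set.Iio c))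
    (hRn : ∀ i < c, R i < n) (π : Equiv.Perm (Fin n))
    (hπ : ∀ k l : Fin n, (l : ℕ) < c → k < l → π k < π l)
    (hle : ∀ k : Fin n, (k : ℕ) < c → (π k : ℕ) ≤ R k) (l : List (Fin n))
    (hl : l.Pairwise (· < ·)) (hlc : ∀ i ∈ l, (i : ℕ) < c)
    (hup : ∀ i ∈ l, ∀ k : Fin n, (k : ℕ) < c → i < k → k ∈ l) :
    let σ := l.foldr (fun (i : Fin n) τ => greedy c (R i) i n τ) π
    (∀ i ∈ l, (σ i : ℕ) = R i) ∧ (∀ i : Fin n, (i : ℕ) < c → i ∉ l → σ i = π i) ∧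
    (∀ x y : Fin n, c ≤ (x : ℕ) → (y : ℕ) = x + 1 → π x < π y → σ x < σ y) ∧
    ∀ d, c ≤ d → IsMergeCount (rankGE π d)
      (fun v => (l.countP (fun i : Fin n => v ≤ R i))) (rankGE σ d) := by
  induction l with
  | nil =>
    refine ⟨by simp, by simp, fun _ _ _ _ h => h, fun d _ => ?_⟩
    exact isMergeCount_zero fun _ _ h => rankGE_anti π d h
  | cons a l ih =>
    rw [List.pairwise_cons] at hl
    have hac : (a : ℕ) < c := hlc a (by simp)
    have hal : a ∉ l := fun h => lt_irrefl _ (hl.1 a h)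
    obtain ⟨h1, h2, h3, h4⟩ := ih hl.2 (fun i hi => hlc i (by simp [hi])) (by
      intro i hi k hk hik
      have := hup i (by simp [hi]) k hk hik
      rw [List.mem_cons] at this
      rcases this with rfl | h
      · exact absurd (hl.1 i hi) hik.asymm
      · exact h)
    dsimp only at h1 h2 h3 h4 ⊢
    rw [List.foldr_cons]
    generalize l.foldr (fun (i : Fin n) τ => greedy c (R i) i n τ) π = τ at *
    have hRa : ∀ k : Fin n, (k : ℕ) < c → a < k → R a < R k := fun k hk h => hR hac hk h
    -- Rows below `a` already hold entries of `R` larger than the target, and rows above still hold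
    -- old entries smaller than `π a`.
    have hg : IsGreedyStep c (R a) a τ (greedy c (R a) a n τ) := by
      refine isGreedyStep_greedy (hRn a hac) hac n τ ?_ ?_ ?_
      · rw [h2 a hac hal]
        exact hle a hac
      · have := hRn a hac
        omega
      · intro k hk hka
        by_cases hkl : k ∈ l
        · rw [h1 k hkl]
          exact Or.inr (hRa k hk (hl.1 k hkl))
        · rw [h2 k hk hkl, h2 a hac hal]
          rcases lt_or_gt_of_ne hka with h | h
          · exact Or.inl (hπ k a hac h)
          · have := hup a (by simp) k hk h
            rw [List.mem_cons] at this
            exact absurd this (by simp [hka, hkl])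
    refine ⟨?_, ?_, ?_, ?_⟩
    · intro i hi
      rw [List.mem_cons] at hi
      rcases hi with rfl | hi
      · exact hg.apply_self
      · rw [hg.apply_of_lt i (hlc i (by simp [hi])) (by rintro rfl; exact hal hi), h1 i hi]
    · intro i hic hi
      rw [List.mem_cons, not_or] at hi
      rw [hg.apply_of_lt i hic hi.1, h2 i hic hi.2]
    · exact fun x y hx hxy h => hg.ascent x y hx hxy (h3 x y hx hxy h)
    · intro d hd
      refine (h4 d hd).step (t := R a) ?_ ?_ (fun v => hg.rank d v hd)
      · intro u hu
        refine List.countP_congr fun i hi => ?_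
        have := hRa i (hlc i (by simp [hi])) (hl.1 i hi)
        simp only [decide_eq_true_eq]
        omega
      · intro u
        rw [List.countP_cons]
        simp only [decide_eq_true_eq]

/-- The effect of the greedy algorithm at all rows of a column of length `c` with entries `R`. -/
lemma foldr_greedy_column {n c : ℕ} (hc : c ≤ n) {R : ℕ → ℕ} (hR : StrictMonoOn R (Set.Iio c))
    (hRn : ∀ i < c, R i < n) (π : Equiv.Perm (Fin n))
    (hπ : ∀ k l : Fin n, (l : ℕ) < c → k < l → π k < π l)
    (hle : ∀ k : Fin n, (k : ℕ) < c → (π k : ℕ) ≤ R k) {σ : Equiv.Perm (Fin n)}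
    (hσ : σ = ((List.finRange n).filter (fun i : Fin n => decide ((i : ℕ) < c))).foldr
      (fun (i : Fin n) τ => greedy c (R i) i n τ) π) :
    (∀ i : Fin n, (i : ℕ) < c → (σ i : ℕ) = R i) ∧
    (∀ x y : Fin n, c ≤ (x : ℕ) → (y : ℕ) = x + 1 → π x < π y → σ x < σ y) ∧
    ∀ d, c ≤ d → IsMergeCount (rankGE π d) (entriesGE R 0 c) (rankGE σ d) := by
  have hmem : ∀ i : Fin n, i ∈ (List.finRange n).filter (fun i : Fin n => decide ((i : ℕ) < c)) ↔
      (i : ℕ) < c := by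
    intro i
    simp
  obtain ⟨h1, -, h3, h4⟩ := foldr_greedy hR hRn π hπ hle _
    ((List.pairwise_lt_finRange n).filter (fun i : Fin n => decide ((i : ℕ) < c)))
    (fun i hi => (hmem i).1 hi) (fun i _ k hk _ => (hmem k).2 hk)
  rw [← hσ] at h1 h3 h4
  refine ⟨fun i hi => h1 i ((hmem i).2 hi), h3, fun d hd => ?_⟩
  convert h4 d hd using 1
  funext v
  rw [List.countP_filter, List.countP_eq_length_filter, entriesGE,
    ← List.toFinset_card_of_nodup ((List.nodup_finRange n).filter _)]
  symm
  refine Finset.card_bij (fun k _ => (k : ℕ)) ?_ ?_ ?_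
  · intro k hk
    simp at hk
    simp [hk]
  · intro k _ l _ hkl
    exact Fin.ext hkl
  · intro i hi
    simp at hi
    exact ⟨⟨i, by omega⟩, by simp [hi], rfl⟩

/-! ### The tableau criterion for the Bruhat order -/

lemma BruhatLE.rankGE_le {n : ℕ} {u w : Equiv.Perm (Fin n)} (h : BruhatLE u w) (c v : ℕ) :
    rankGE u c v ≤ rankGE w c v := by
  induction h with
  | refl => exact le_rfl
  | tail _ hstep ih =>
    obtain ⟨a, b, hab, hu, rfl⟩ := hstep
    rw [rankGE_mul_swap _ hab hu]
    omega

/-- Let `a` be the first place where `u` and `w` differ and `b` the first later place with `u a < u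
b ≤ w a`. Interchanging these entries of `u` goes up in the Bruhat order, stays below `w` in all
ranks, and lowers the total rank deficit. -/
lemma bruhatLE_of_rankGE_le {n : ℕ} {u w : Equiv.Perm (Fin n)}
    (h : ∀ c v, rankGE u c v ≤ rankGE w c v) : BruhatLE u w := by
  induction hm : ∑ c ∈ Finset.range n, ∑ v ∈ Finset.range n, (rankGE w c v - rankGE u c v)
    using Nat.strong_induction_on generalizing u with
  | _ m ih =>
    by_cases huw : u = w
    · subst huw
      exact Relation.ReflTransGen.refl
    obtain ⟨a, ha, hmin⟩ : ∃ a, u a ≠ w a ∧ ∀ x < a, u x = w x := by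
      have hex : (Finset.univ.filter fun a => u a ≠ w a).Nonempty := by
        by_contra hne
        rw [Finset.not_nonempty_iff_eq_empty, Finset.filter_eq_empty_iff] at hne
        exact huw (Equiv.ext fun a => not_not.1 (hne (Finset.mem_univ a)))
      obtain ⟨a, ha⟩ := Finset.exists_minimal hex
      refine ⟨a, by simpa using ha.1, fun x hx => ?_⟩
      by_contra hne
      exact absurd (ha.2 (by simpa using hne) hx.le) (not_le.2 hx)
    have hrank : ∀ v, rankGE u a v = rankGE w a v := by
      intro v
      unfold rankGE
      congr 1
      ext k
      simp only [Finset.mem_filter, Finset.mem_univ, true_and]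
      refine and_congr_right fun hk => ?_
      rw [hmin k hk]
    have hau : u a < w a := by
      have h1 := h (a + 1) (u a)
      rw [rankGE_succ, rankGE_succ, hrank, if_pos le_rfl] at h1
      refine lt_of_le_of_ne ?_ ha
      by_contra h2
      rw [if_neg (fun h3 : (u a : ℕ) ≤ w a => h2 h3)] at h1
      omega
    obtain ⟨b, ⟨hab, hub, hbw⟩, hbmin⟩ : ∃ b, (a < b ∧ u a < u b ∧ u b ≤ w a) ∧
        ∀ x < b, ¬ (a < x ∧ u a < u x ∧ u x ≤ w a) := by
      have hex : (Finset.univ.filter fun b => a < b ∧ u a < u b ∧ u b ≤ w a).Nonempty := by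
        refine ⟨u.symm (w a), ?_⟩
        simp only [Finset.mem_filter, Finset.mem_univ, true_and, Equiv.apply_symm_apply, le_refl,
          and_true]
        refine ⟨?_, hau⟩
        rcases lt_trichotomy (u.symm (w a)) a with h1 | h1 | h1
        · have h2 := hmin _ h1
          rw [Equiv.apply_symm_apply] at h2
          exact absurd (w.injective h2).symm h1.ne
        · exact absurd (by rw [← h1, Equiv.apply_symm_apply, h1]) ha
        · exact h1
      obtain ⟨b, hb⟩ := Finset.exists_minimal hex
      refine ⟨b, by simpa using hb.1, fun x hx hxx => ?_⟩
      exact absurd (hb.2 (by simpa using hxx) hx.le) (not_le.2 hx)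
    have hab' : (a : ℕ) < b := hab
    have hau' : (u a : ℕ) < w a := hau
    have hub' : (u a : ℕ) < u b := hub
    have hbw' : (u b : ℕ) ≤ w a := hbw
    have hlt : ∀ c v, ((a : ℕ) < c ∧ c ≤ b) ∧ ((u a : ℕ) < v ∧ v ≤ u b) →
        rankGE u c v < rankGE w c v := by
      rintro c v ⟨⟨hac, hcb⟩, hav, hvb⟩
      have hsplit : ∀ (π : Equiv.Perm (Fin n)) (d : ℕ), rankGE π d v = rankGE π d (w a + 1) +
          (Finset.univ.filter fun k : Fin n => (k : ℕ) < d ∧ v ≤ π k ∧ π k ≤ w a).card := by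
        intro π d
        unfold rankGE
        rw [← Finset.card_union_of_disjoint]
        · congr 1
          ext k
          simp only [Finset.mem_filter, Finset.mem_univ, true_and, Finset.mem_union, Fin.le_def]
          omega
        · rw [Finset.disjoint_left]
          intro k
          simp only [Finset.mem_filter, Finset.mem_univ, true_and, Fin.le_def]
          omega
      -- By the choice of `b`, the values of `u` in `[v, w a]` before `c` all stand before `a`,
      -- where `u` and `w` agree; `w` has `w a` in addition.
      have hcard : (Finset.univ.filter fun k : Fin n =>
            (k : ℕ) < c ∧ v ≤ u k ∧ u k ≤ w a).card <
          (Finset.univ.filter fun k : Fin n => (k : ℕ) < c ∧ v ≤ w k ∧ w k ≤ w a).card := by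
        apply Finset.card_lt_card
        have hsub : ∀ k : Fin n, (k : ℕ) < c → v ≤ u k → u k ≤ w a → k < a := by
          intro k hk h1 h2
          by_contra hka
          rcases eq_or_lt_of_le (not_lt.1 hka) with rfl | hka
          · omega
          · exact hbmin k (by rw [Fin.lt_def]; omega) ⟨hka, by rw [Fin.lt_def]; omega, h2⟩
        rw [Finset.ssubset_iff_of_subset]
        · refine ⟨a, ?_, ?_⟩
          · simp only [Finset.mem_filter, Finset.mem_univ, true_and, le_refl, and_true]
            omega
          · simp only [Finset.mem_filter, Finset.mem_univ, true_and]
            rintro ⟨h1, h2, h3⟩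
            exact lt_irrefl _ (hsub a h1 h2 h3)
        · intro k
          simp only [Finset.mem_filter, Finset.mem_univ, true_and]
          rintro ⟨h1, h2, h3⟩
          rw [← hmin k (hsub k h1 h2 h3)]
          exact ⟨h1, h2, h3⟩
      rw [hsplit u, hsplit w]
      have := h c (w a + 1)
      omega
    have hswap : ∀ c v, rankGE (u * Equiv.swap a b) c v ≤ rankGE w c v := by
      intro c v
      rw [rankGE_mul_swap u hab hub]
      split_ifs with h1
      · exact hlt c v h1
      · exact h c v
    refine Relation.ReflTransGen.head ⟨a, b, hab, hub, rfl⟩ (ih _ ?_ hswap rfl)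
    rw [← hm]
    have hterm : ∀ c v, rankGE w c v - rankGE (u * Equiv.swap a b) c v ≤
        rankGE w c v - rankGE u c v := by
      intro c v
      rw [rankGE_mul_swap u hab hub]
      omega
    refine Finset.sum_lt_sum (fun c _ => Finset.sum_le_sum fun v _ => hterm c v)
      ⟨b, Finset.mem_range.2 b.2, ?_⟩
    refine Finset.sum_lt_sum (fun v _ => hterm b v) ⟨u b, Finset.mem_range.2 (u b).2, ?_⟩
    have hcond : ((a : ℕ) < b ∧ (b : ℕ) ≤ b) ∧ ((u a : ℕ) < u b ∧ (u b : ℕ) ≤ u b) := by omega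
    have := hlt b (u b) hcond
    rw [rankGE_mul_swap u hab hub, if_pos hcond]
    omega

lemma rankGE_zero {n : ℕ} (π : Equiv.Perm (Fin n)) (v : ℕ) : rankGE π 0 v = 0 := by
  unfold rankGE
  simp

lemma rankGE_card {n : ℕ} (π : Equiv.Perm (Fin n)) (v : ℕ) :
    rankGE π n v = (Finset.univ.filter fun x : Fin n => v ≤ (x : ℕ)).card := by
  unfold rankGE
  refine Finset.card_bij (fun k _ => π k) ?_ (fun _ _ _ _ h => π.injective h) ?_
  · intro k hk
    simpa using hk
  · intro x hx
    exact ⟨π.symm x, by simpa using hx, by simp⟩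

/-- It suffices to compare `u` and `w` at the descents of `u`. -/
lemma rankGE_le_of_descents {n : ℕ} {u w : Equiv.Perm (Fin n)} {S : Set ℕ}
    (hS : ∀ x y : Fin n, (y : ℕ) = x + 1 → (y : ℕ) ∉ S → u x < u y)
    (h : ∀ c ∈ S, ∀ v, rankGE u c v ≤ rankGE w c v) {c : ℕ} (hc : c ≤ n) (v : ℕ) :
    rankGE u c v ≤ rankGE w c v := by
  -- If `u x < v`, the rank of `u` is the same at `x` as at `x + 1`. Ascents keep the earlier values
  -- below `v`, so one walks left to a point of `S` or to 0.
  have hdown : ∀ x : Fin n, (u x : ℕ) < v → rankGE u (x + 1) v ≤ rankGE w (x + 1) v := by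
    rintro ⟨x, hx⟩
    induction x with
    | zero =>
      intro hv
      rw [rankGE_succ, if_neg (by omega), rankGE_zero]
      omega
    | succ x ih =>
      intro hv
      have hmono := rankGE_mono_left w (show x + 1 ≤ x + 1 + 1 by omega) v
      rw [rankGE_succ u ⟨x + 1, hx⟩, if_neg (by omega)]
      simp only [add_zero]
      by_cases hxS : x + 1 ∈ S
      · exact (h _ hxS v).trans hmono
      · have h1 := hS ⟨x, by omega⟩ ⟨x + 1, hx⟩ rfl hxS
        rw [Fin.lt_def] at h1
        exact (ih (by omega) (by omega)).trans hmono
  -- If `v ≤ u x`, one walks right to a point of `S` or to `n`: each step adds 1 to the rank of `u`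
  -- and at most 1 to that of `w`. Here `k` is the number of positions after `x`.
  have hup : ∀ k x (hk : x + k + 1 = n), v ≤ (u ⟨x, by omega⟩ : ℕ) →
      rankGE u x v ≤ rankGE w x v := by
    intro k
    induction k with
    | zero =>
      rintro x hx hv
      have h1 := rankGE_succ u ⟨x, by omega⟩ v
      have h2 := rankGE_succ w ⟨x, by omega⟩ v
      simp only [show x + 1 = n by omega, rankGE_card] at h1 h2
      rw [if_pos hv] at h1
      split_ifs at h2 <;> omega
    | succ k ih =>
      rintro x hx hv
      have h1 := rankGE_succ u ⟨x, by omega⟩ v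
      have h2 := rankGE_succ w ⟨x, by omega⟩ v
      rw [if_pos hv] at h1
      simp only at h1 h2
      have h3 : rankGE u (x + 1) v ≤ rankGE w (x + 1) v := by
        by_cases hxS : x + 1 ∈ S
        · exact h _ hxS v
        · have h4 := hS ⟨x, by omega⟩ ⟨x + 1, by omega⟩ rfl hxS
          rw [Fin.lt_def] at h4
          exact ih (x + 1) (by omega) (by omega)
      split_ifs at h2 <;> omega
  rcases Nat.eq_zero_or_pos c with rfl | hpos
  · rw [rankGE_zero]
    omega
  obtain ⟨x, rfl⟩ : ∃ x, c = x + 1 := ⟨c - 1, by omega⟩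
  by_cases hv : (u ⟨x, hc⟩ : ℕ) < v
  · exact hdown ⟨x, hc⟩ hv
  by_cases hxS : x + 1 ∈ S
  · exact h _ hxS v
  rcases eq_or_lt_of_le hc with rfl | hlt
  · rw [rankGE_card, rankGE_card]
  · have h4 := hS ⟨x, by omega⟩ ⟨x + 1, hlt⟩ rfl hxS
    rw [Fin.lt_def] at h4
    exact hup (n - (x + 1) - 1) (x + 1) (by omega) (by omega)

lemma rankGE_of_le {n : ℕ} (π : Equiv.Perm (Fin n)) {c : ℕ} (hc : n ≤ c) (v : ℕ) :
    rankGE π c v = rankGE π n v := by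
  unfold rankGE
  congr 1
  ext k
  simp only [Finset.mem_filter, Finset.mem_univ, true_and]
  have := k.2
  omega

/-- The tableau criterion: the Bruhat order is detected at the descents of the smaller element. -/
theorem bruhatLE_iff_of_descents {n : ℕ} {u w : Equiv.Perm (Fin n)} {S : Set ℕ}
    (hS : ∀ x y : Fin n, (y : ℕ) = x + 1 → (y : ℕ) ∉ S → u x < u y) :
    BruhatLE u w ↔ ∀ c ∈ S, ∀ v, rankGE u c v ≤ rankGE w c v := by
  refine ⟨fun h c _ v => h.rankGE_le c v, fun h => bruhatLE_of_rankGE_le fun c v => ?_⟩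
  rcases le_total c n with hc | hc
  · exact rankGE_le_of_descents hS h hc v
  · rw [rankGE_of_le u hc, rankGE_of_le w hc]
    exact rankGE_le_of_descents hS h le_rfl v

/-! ### Keys of permutations -/

/-- `Nat.nth` enumerates a finite set increasingly only below its cardinality, which is the column
length here because `w` is injective and the length is at most `n`. -/
lemma keyOfPerm_spec {n : ℕ} (μ : YoungDiagram) (w : Equiv.Perm (Fin n)) {j : ℕ}
    (hj : μ.colLen j ≤ n) :
    StrictMonoOn (fun i => keyOfPerm μ w i j) (Set.Iio (μ.colLen j)) ∧
    ∀ v, entriesGE (fun i => keyOfPerm μ w i j) 0 (μ.colLen j) v = rankGE w (μ.colLen j) v := by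
  unfold keyOfPerm
  generalize μ.colLen j = c at *
  set P : ℕ → Prop := fun x => ∃ k : Fin n, (k : ℕ) < c ∧ (w k : ℕ) = x with hP
  have hf : (Set.ofPred P).Finite := by
    refine (Set.finite_Iio n).subset ?_
    rintro x ⟨k, -, rfl⟩
    exact (w k).2
  have hinj : Function.Injective fun k : Fin n => (w k : ℕ) :=
    Fin.val_injective.comp w.injective
  have hset : ∀ v, hf.toFinset.filter (fun x => v ≤ x) =
      (Finset.univ.filter fun k : Fin n => (k : ℕ) < c ∧ v ≤ (w k : ℕ)).image
        fun k => (w k : ℕ) := by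
    intro v
    ext x
    simp only [Finset.mem_filter, Set.Finite.mem_toFinset, Finset.mem_image, Finset.mem_univ,
      true_and]
    constructor
    · rintro ⟨⟨k, hk, rfl⟩, hv⟩
      exact ⟨k, ⟨hk, hv⟩, rfl⟩
    · rintro ⟨k, ⟨hk, hv⟩, rfl⟩
      exact ⟨⟨k, hk, rfl⟩, hv⟩
  have hcard : hf.toFinset.card = c := by
    have h0 := hset 0
    rw [Finset.filter_true_of_mem (fun _ _ => Nat.zero_le _)] at h0
    rw [h0, Finset.card_image_of_injective _ hinj]
    simp only [Nat.zero_le, and_true]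
    rw [Fin.card_filter_val_lt, min_eq_right hj]
  have hmono : StrictMonoOn (Nat.nth P) (Set.Iio c) := by
    have := Nat.nth_strictMonoOn hf
    rwa [hcard] at this
  refine ⟨hmono, fun v => ?_⟩
  rw [rankGE, ← Finset.card_image_of_injective _ hinj, ← hset, entriesGE]
  refine Finset.card_bij (fun i _ => Nat.nth P i) ?_ ?_ ?_
  · intro i hi
    simp only [Finset.mem_filter, Finset.mem_Ico] at hi
    simp only [Finset.mem_filter, Set.Finite.mem_toFinset]
    exact ⟨Nat.nth_mem_of_lt_card hf (by omega), hi.2⟩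
  · intro i hi k hk h
    simp only [Finset.mem_filter, Finset.mem_Ico] at hi hk
    exact hmono.injOn hi.1.2 hk.1.2 h
  · intro x hx
    simp only [Finset.mem_filter, Set.Finite.mem_toFinset] at hx
    obtain ⟨i, hi, rfl⟩ := Nat.exists_lt_card_finite_nth_eq hf hx.1
    refine ⟨i, ?_, rfl⟩
    simp only [Finset.mem_filter, Finset.mem_Ico]
    exact ⟨by omega, hx.2⟩

/-! ### Tableaux -/

lemma Tableau.strictMonoOn {n : ℕ} {μ : YoungDiagram} (T : Tableau n μ) (j : ℕ) :
    StrictMonoOn (fun i => T.val i j) (Set.Iio (μ.colLen j)) := fun _ _ _ hk h =>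
  T.1.col_strict h (YoungDiagram.mem_iff_lt_colLen.2 hk)

lemma Tableau.val_lt {n : ℕ} {μ : YoungDiagram} (T : Tableau n μ) {i j : ℕ}
    (h : i < μ.colLen j) : T.val i j < n :=
  T.2 i j (YoungDiagram.mem_iff_lt_colLen.2 h)

lemma Tableau.val_le_succ {n : ℕ} {μ : YoungDiagram} (T : Tableau n μ) {i j : ℕ}
    (h : i < μ.colLen (j + 1)) : T.val i j ≤ T.val i (j + 1) :=
  T.1.row_weak (Nat.lt_succ_self j) (YoungDiagram.mem_iff_lt_colLen.2 h)

/-- Sorting stably by a key with values 0 and 1 gives two increasing blocks, the first of which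
enumerates column `0`. -/
lemma initialPerm_spec {n : ℕ} {μ : YoungDiagram} (hn : μ.colLen 0 ≤ n) (T : Tableau n μ) :
    (∀ k : Fin n, (k : ℕ) < μ.colLen 0 → (initialPerm T k : ℕ) = T.val k 0) ∧
    ∀ x y : Fin n, (y : ℕ) = x + 1 → (y : ℕ) ≠ μ.colLen 0 → initialPerm T x < initialPerm T y := by
  have hT := T.strictMonoOn 0
  have hTn := fun i => T.val_lt (i := i) (j := 0)
  obtain ⟨hmono, hstable⟩ := Tuple.eq_sort_iff.1 (rfl : initialPerm T = Tuple.sort fun x : Fin n =>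
    if (x : ℕ) ∈ (Finset.range (μ.colLen 0)).image (fun i => T.val i 0) then (0 : ℕ) else 1)
  generalize initialPerm T = σ at *
  generalize μ.colLen 0 = c at *
  set f : Fin n → ℕ := fun x =>
    if (x : ℕ) ∈ (Finset.range c).image (fun i => T.val i 0) then (0 : ℕ) else 1 with hf
  have hf0 : ∀ x, f x ≤ 0 ↔ (x : ℕ) ∈ (Finset.range c).image (fun i => T.val i 0) := by
    intro x
    rw [hf]
    dsimp only
    split_ifs with h <;> simp [h]
  have hcard : (Finset.univ.filter fun i => (f ∘ σ) i ≤ 0).card = c := by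
    refine Eq.trans (Eq.symm ?_) (Finset.card_range c)
    refine Finset.card_bij
      (fun i hi => σ.symm ⟨T.val i 0, hTn i (Finset.mem_range.1 hi)⟩) ?_ ?_ ?_
    · intro i hi
      simp only [Finset.mem_filter, Finset.mem_univ, true_and, Function.comp_apply,
        Equiv.apply_symm_apply]
      rw [hf0]
      exact Finset.mem_image.2 ⟨i, hi, rfl⟩
    · intro i hi k hk h
      exact hT.injOn (Finset.mem_range.1 hi) (Finset.mem_range.1 hk)
        (Fin.mk.inj_iff.1 (σ.symm.injective h))
    · intro x hx
      simp only [Finset.mem_filter, Finset.mem_univ, true_and, Function.comp_apply] at hx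
      rw [hf0] at hx
      obtain ⟨i, hi, hx⟩ := Finset.mem_image.1 hx
      exact ⟨i, hi, σ.symm_apply_eq.2 (Fin.ext hx)⟩
  have hlt : ∀ k : Fin n, (k : ℕ) < c ↔ f (σ k) ≤ 0 := by
    intro k
    have := Tuple.lt_card_le_iff_apply_le_of_monotone (a := 0) (j := k) hmono
    rwa [hcard] at this
  constructor
  · have hs : ((Finset.range c).image (fun i => T.val i 0)).card = c := by
      rw [Finset.card_image_of_injOn, Finset.card_range]
      rw [Finset.coe_range]
      exact hT.injOn
    have h1 : (fun k : Fin c => (σ ⟨k, k.2.trans_le hn⟩ : ℕ)) = _ :=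
      Finset.orderEmbOfFin_unique hs (fun k => (hf0 _).1 ((hlt _).1 k.2)) (by
        intro k l hkl
        have hk := (hlt ⟨k, k.2.trans_le hn⟩).1 k.2
        have hl := (hlt ⟨l, l.2.trans_le hn⟩).1 l.2
        exact hstable _ _ (Fin.mk_lt_mk.2 hkl)
          ((Nat.le_zero.1 hk).trans (Nat.le_zero.1 hl).symm))
    have h2 : (fun k : Fin c => T.val k 0) = _ :=
      Finset.orderEmbOfFin_unique hs
        (fun k => Finset.mem_image.2 ⟨k, Finset.mem_range.2 k.2, rfl⟩)
        (fun k l hkl => hT k.2 l.2 hkl)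
    intro k hk
    exact congrFun (h1.trans h2.symm) ⟨k, hk⟩
  · intro x y hxy hyc
    refine hstable x y (by rw [Fin.lt_def]; omega) ?_
    have h1 := hlt x
    have h2 := hlt y
    have h3 : ∀ z, f z ≤ 1 := by
      intro z
      rw [hf]
      dsimp only
      split_ifs <;> omega
    have h4 := h3 (σ x)
    have h5 := h3 (σ y)
    change f (σ x) = f (σ y)
    omega

lemma strictMonoOn_perm_of_eq {n : ℕ} {μ : YoungDiagram} (T : Tableau n μ) {j : ℕ}
    {π : Equiv.Perm (Fin n)} (h : ∀ k : Fin n, (k : ℕ) < μ.colLen j → (π k : ℕ) = T.val k j)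
    (k l : Fin n) (hl : (l : ℕ) < μ.colLen j) (hkl : k < l) : π k < π l := by
  have hk : (k : ℕ) < μ.colLen j := lt_trans hkl hl
  rw [Fin.lt_def, h k hk, h l hl]
  exact T.strictMonoOn j hk hl hkl

lemma columnPerm_succ_of_eq {n : ℕ} {μ : YoungDiagram} {j : ℕ} (hc : μ.colLen (j + 1) ≤ n)
    (T : Tableau n μ)
    (h : ∀ k : Fin n, (k : ℕ) < μ.colLen j → (columnPerm T j k : ℕ) = T.val k j) :
    (∀ i : Fin n, (i : ℕ) < μ.colLen (j + 1) → (columnPerm T (j + 1) i : ℕ) = T.val i (j + 1)) ∧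
    (∀ x y : Fin n, μ.colLen (j + 1) ≤ (x : ℕ) → (y : ℕ) = x + 1 →
      columnPerm T j x < columnPerm T j y → columnPerm T (j + 1) x < columnPerm T (j + 1) y) ∧
    ∀ d, μ.colLen (j + 1) ≤ d → IsMergeCount (rankGE (columnPerm T j) d)
      (entriesGE (fun i => T.val i (j + 1)) 0 (μ.colLen (j + 1)))
      (rankGE (columnPerm T (j + 1)) d) := by
  have hcj := μ.colLen_anti j (j + 1) (Nat.le_succ j)
  refine foldr_greedy_column hc (T.strictMonoOn (j + 1)) (fun i hi => T.val_lt hi)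
    (columnPerm T j) (fun k l hl => strictMonoOn_perm_of_eq T h k l (by omega)) ?_ rfl
  intro k hk
  rw [h k (by omega)]
  exact T.val_le_succ hk

lemma slideState_movedColumn {n : ℕ} {μ : YoungDiagram} (T : Tableau n μ) (j m : ℕ)
    (h1 : StrictMonoOn (movedColumn T j m) (Set.Iio (μ.colLen j)))
    (h2 : ∀ i < μ.colLen (j + m), movedColumn T j m i ≤ T.val i (j + m)) :
    SlideState (μ.colLen j) (μ.colLen (j + (m + 1))) 0 (movedColumn T j m)
      (fun i => T.val i (j + (m + 1))) := by
  have hc := μ.colLen_anti (j + m) (j + (m + 1)) (by omega)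
  refine slideState_zero h1 (T.strictMonoOn _) fun i hi => ?_
  exact (h2 i (by omega)).trans (T.val_le_succ hi)

/-- Before the current column length the entries are those of a column, hence increasing; from there
on the greedy algorithm preserves ascents. Descents thus occur only at column lengths already met.
-/
lemma columnPerm_spec {n : ℕ} {μ : YoungDiagram} (hn : μ.colLen 0 ≤ n) (T : Tableau n μ) (j : ℕ) :
    (∀ k : Fin n, (k : ℕ) < μ.colLen j → (columnPerm T j k : ℕ) = T.val k j) ∧
    ∀ x y : Fin n, (y : ℕ) = x + 1 → (∀ i ≤ j, (y : ℕ) ≠ μ.colLen i) →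
      columnPerm T j x < columnPerm T j y := by
  induction j with
  | zero =>
    obtain ⟨h1, h2⟩ := initialPerm_spec hn T
    exact ⟨h1, fun x y hxy h => h2 x y hxy (h 0 le_rfl)⟩
  | succ j ih =>
    obtain ⟨h1, h2⟩ := ih
    have hcj := μ.colLen_anti j (j + 1) (by omega)
    have hc := (μ.colLen_anti 0 (j + 1) (by omega)).trans hn
    obtain ⟨h3, h4, -⟩ := columnPerm_succ_of_eq hc T h1
    refine ⟨h3, fun x y hxy hy => ?_⟩
    by_cases hx : μ.colLen (j + 1) ≤ x
    · exact h4 x y hx hxy (h2 x y hxy fun i hi => hy i (by omega))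
    · have := hy (j + 1) le_rfl
      rw [Fin.lt_def, h3 x (by omega), h3 y (by omega)]
      exact T.strictMonoOn (j + 1) (show (x : ℕ) < _ by omega) (show (y : ℕ) < _ by omega)
        (by omega)

lemma movedColumn_spec {n : ℕ} {μ : YoungDiagram} (T : Tableau n μ) (j m : ℕ) :
    StrictMonoOn (movedColumn T j m) (Set.Iio (μ.colLen j)) ∧
    ∀ i < μ.colLen (j + m), movedColumn T j m i ≤ T.val i (j + m) := by
  induction m with
  | zero => exact ⟨T.strictMonoOn j, fun i _ => le_rfl⟩
  | succ m ih =>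
    have hs := slideState_movedColumn T j m ih.1 ih.2
    have hc := μ.colLen_anti j (j + (m + 1)) (by omega)
    have h1 := hs.slides (μ.colLen j - μ.colLen (j + (m + 1))) (by omega)
    refine ⟨h1.right.mono fun i hi => ?_, fun i hi => slides_right_le hs _ (by omega) i hi⟩
    simp only [Set.mem_Iio] at hi ⊢
    omega

lemma rankGE_columnPerm {n : ℕ} {μ : YoungDiagram} (hn : μ.colLen 0 ≤ n) (T : Tableau n μ)
    (j m v : ℕ) : rankGE (columnPerm T (j + m)) (μ.colLen j) v =
      entriesGE (movedColumn T j m) 0 (μ.colLen j) v := by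
  induction m generalizing v with
  | zero =>
    exact rankGE_eq_entriesGE _ ((μ.colLen_anti 0 j (by omega)).trans hn)
      (columnPerm_spec hn T j).1 v
  | succ m ih =>
    obtain ⟨h1, h2⟩ := movedColumn_spec T j m
    have hc := μ.colLen_anti j (j + (m + 1)) (by omega)
    have hs := isMergeCount_slides (slideState_movedColumn T j m h1 h2) hc
    obtain ⟨-, -, h3⟩ := columnPerm_succ_of_eq (j := j + m)
      -- The merging rule holds for prefixes of every length from that of the current column on, in
      -- particular for the longer prefix of length `μ.colLen j`.
      ((μ.colLen_anti 0 (j + (m + 1)) (by omega)).trans hn) T (columnPerm_spec hn T (j + m)).1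
    have h4 := h3 _ hc
    rw [funext ih] at h4
    exact h4.unique hs v

end Demazure

theorem theorem6p2 {n : ℕ} (μ : YoungDiagram) (hμ : μ ≠ ⊥) (hn : μ.colLen 0 < n)
    (T : Demazure.Tableau n μ) (w : Equiv.Perm (Fin n)) (hw : w ∈ Demazure.minimalReps n μ) :
    T ∈ Demazure.demazureSet μ w ↔ Demazure.BruhatLE (Demazure.finalPerm T) w := by
  -- With the column lengths as `S`, the criterion splits over the columns of the two keys.
  rw [Demazure.bruhatLE_iff_of_descents (S := {c | ∃ j ≤ μ.rowLen 0 - 1, c = μ.colLen j})]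
  · have key : ∀ j ≤ μ.rowLen 0 - 1,
        (∀ i < μ.colLen j, Demazure.rightKey T i j ≤ Demazure.keyOfPerm μ w i j) ↔
        ∀ v, Demazure.rankGE (Demazure.finalPerm T) (μ.colLen j) v ≤
          Demazure.rankGE w (μ.colLen j) v := by
      intro j hj
      obtain ⟨h1, h2⟩ := Demazure.keyOfPerm_spec μ w ((μ.colLen_anti 0 j (Nat.zero_le j)).trans hn.le)
      have h3 := Demazure.rankGE_columnPerm hn.le T j (μ.rowLen 0 - 1 - j)
      rw [Nat.add_sub_cancel' hj] at h3
      refine (Demazure.le_iff_entriesGE_le (Demazure.movedColumn_spec T j _).1 h1).trans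
        (forall_congr' fun v => ?_)
      rw [h2, ← h3]
      rfl
    constructor
    · rintro hT c ⟨j, hj, rfl⟩
      exact (key j hj).1 fun i hi => hT i j (YoungDiagram.mem_iff_lt_colLen.2 hi)
    · intro h i j hij
      have hj : j < μ.rowLen 0 :=
        (YoungDiagram.mem_iff_lt_rowLen.1 hij).trans_le (μ.rowLen_anti 0 i (Nat.zero_le i))
      exact (key j (by omega)).2 (h _ ⟨j, by omega, rfl⟩) i (YoungDiagram.mem_iff_lt_colLen.1 hij)
  · intro x y hxy hy
    exact (Demazure.columnPerm_spec hn.le T _).2 x y hxy fun i hi h => hy ⟨i, hi, h⟩
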